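/- For $\lambda=(\sigma,b,r)\in(0,\infty)^3$ consider the Lorenz system $$x'=-\sigma x+\sigma y,\qquad y'=rx-y-xz,\qquad z'=-bz+xy .$$ Its solutions on $[0,\infty)$ generate a unique continuous semigroup $S_\lambda(t)$, $t\ge 0$, on $\mathbb R^3$ ($S_\lambda(t)u_0$ is the value at time $t$ of the unique solution starting at $u_0$), and $S_\lambda$ has a unique global attractor $\mathscr A_\lambda$, that is, a compact set with $S_\lambda(t)\mathscr A_\lambda=\mathscr A_\lambda$ for all $t\ge0$ and $\sup_{u\in B}\operatorname{dist}(S_\lambda(t)u,\mathscr A_\lambda)\to0$ as $t\to\infty$ for every bounded $B\subseteq\mathbb R^3$. The set $\mathscr A_\lambda$ is non-empty. Let $CB(\mathbb R^3)$ be the set of non-empty closed bounded subsets of $\mathbb R^3$ with the Hausdorff metric. Then there is a residual and dense subset $\Lambda_*$ of $(0,\infty)^3$ such that the map $(0,\infty)^3\to CB(\mathbb R^3)$, $\lambda\mapsto\mathscr A_\lambda$, is continuous at every $\lambda\in\Lambda_*$. (A set is residual if its complement is a countable union of nowhere dense sets.) -/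

import Mathlib

open Filter Topology
open scoped NNReal ENNReal

/-- The nonempty closed bounded subsets of a metric space `Y`. -/
structure CB (Y : Type*) [MetricSpace Y] where
  carrier : Set Y
  nonempty : carrier.Nonempty
  isClosed : IsClosed carrier
  isBounded : Bornology.IsBounded carrier

theorem CB.ext_carrier {Y : Type*} [MetricSpace Y] {A B : CB Y}
    (h : A.carrier = B.carrier) : A = B := by
  cases A; cases B; cases h; rfl

theorem CB.hausdorffEDist_ne_top {Y : Type*} [MetricSpace Y] (A B : CB Y) :
    Metric.hausdorffEDist A.carrier B.carrier ≠ ⊤ :=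
  Metric.hausdorffEDist_ne_top_of_nonempty_of_bounded A.nonempty B.nonempty
    A.isBounded B.isBounded

/-- `CB Y` with the symmetric Hausdorff distance. -/
noncomputable instance CB.instMetricSpace {Y : Type*} [MetricSpace Y] : MetricSpace (CB Y) where
  dist A B := Metric.hausdorffDist A.carrier B.carrier
  dist_self A := Metric.hausdorffDist_self_zero
  dist_comm A B := Metric.hausdorffDist_comm
  dist_triangle A B C := Metric.hausdorffDist_triangle (CB.hausdorffEDist_ne_top A B)
  eq_of_dist_eq_zero {A B} h := CB.ext_carrier
    ((A.isClosed.hausdorffDist_zero_iff_eq B.isClosed (CB.hausdorffEDist_ne_top A B)).1 h)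

/-- The Hausdorff semi-distance `sup_{a ∈ A} inf_{c ∈ C} d(a, c)`. -/
noncomputable def hausdorffSemiDist {X : Type*} [MetricSpace X] (A C : Set X) : ℝ≥0∞ :=
  ⨆ a ∈ A, Metric.infEDist a C

/-- A continuous semigroup `S(t)`, `t ≥ 0`, on `X`. -/
structure IsContinuousSemigroup {X : Type*} [MetricSpace X] (S : ℝ≥0 → X → X) : Prop where
  zero : ∀ x, S 0 x = x
  add : ∀ s t x, S (s + t) x = S s (S t x)
  continuous : Continuous fun q : ℝ≥0 × X => S q.1 q.2

/-- `A` is the global attractor of `S`: compact, invariant, and attracting every bounded set.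
These properties determine `A` (in particular they force it to be minimal among compact
attracting sets). -/
structure IsGlobalAttractor {X : Type*} [MetricSpace X] (S : ℝ≥0 → X → X) (A : Set X) :
    Prop where
  isCompact : IsCompact A
  invariant : ∀ t, S t '' A = A
  attracts : ∀ B : Set X, Bornology.IsBounded B →
    Tendsto (fun t => hausdorffSemiDist (S t '' B) A) atTop (𝓝 0)

/-- The parameter space `(0, ∞)³`, with coordinates `(σ, b, r)`. -/
abbrev LorenzParam : Type := {p : EuclideanSpace ℝ (Fin 3) // ∀ i, 0 < p i}

namespace LorenzParam

def σ (p : LorenzParam) : ℝ := p.1 0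

def b (p : LorenzParam) : ℝ := p.1 1

def r (p : LorenzParam) : ℝ := p.1 2

end LorenzParam

/-- The right-hand side of the Lorenz equations at `u = (x, y, z)`. -/
noncomputable def lorenzField (p : LorenzParam) (u : EuclideanSpace ℝ (Fin 3)) :
    EuclideanSpace ℝ (Fin 3) :=
  !₂[-p.σ * u 0 + p.σ * u 1,
     p.r * u 0 - u 1 - u 0 * u 2,
     -p.b * u 2 + u 0 * u 1]

/-- `u` solves the Lorenz equations on `[0, ∞)` (one-sided derivative at `0`; the values of `u`
at negative times are irrelevant). -/
def IsLorenzSolution (p : LorenzParam) (u : ℝ → EuclideanSpace ℝ (Fin 3)) : Prop :=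
  ∀ t ∈ Set.Ici (0 : ℝ), HasDerivWithinAt u (lorenzField p (u t)) (Set.Ici 0) t

/-- `S` is the semigroup generated by the solutions of the Lorenz equations: `t ↦ S(t)x` is a
solution starting at `x`, and it is the only one. -/
structure IsLorenzSemigroup (p : LorenzParam)
    (S : ℝ≥0 → EuclideanSpace ℝ (Fin 3) → EuclideanSpace ℝ (Fin 3)) : Prop where
  semigroup : IsContinuousSemigroup S
  solution : ∀ x, IsLorenzSolution p fun t : ℝ => S t.toNNReal x
  unique : ∀ u, IsLorenzSolution p u → ∀ t : ℝ≥0, u t = S t (u 0)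

/-! The Lorenz attractor depends upper semicontinuously on the parameter, and an upper
semicontinuous compact-valued map can jump only on a meagre set. The quantity `x² + y² + (z - σ -
r)²` satisfies `V' ≤ -rate * V + source` (`two_mul_inner_lorenzField_le`). This excludes blow-up and
gives a compact absorbing ball, locally bounded in the parameter. The attractor is the intersection
of the images of that ball. Upper semicontinuity (`upperSemicontinuous_lorenzAttractor`): at a time
`T` when the flow of `p₀` has brought a large ball close to its attractor, the flow of a nearby `p`
is still uniformly close to it, and the attractor of `p` is its own image at time `T`. Fort's
theorem then gives the residual set, and Baire's theorem its density. -/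

/-! ### Uniqueness and existence of global attractors. -/

theorem mem_closure_of_hausdorffSemiDist_eq_zero {X : Type*} [MetricSpace X] {A C : Set X}
    (h : hausdorffSemiDist A C = 0) : A ⊆ closure C := by
  intro a ha
  rw [Metric.mem_closure_iff_infEDist_zero]
  have : Metric.infEDist a C ≤ hausdorffSemiDist A C :=
    le_iSup₂ (f := fun a (_ : a ∈ A) => Metric.infEDist a C) a ha
  exact le_antisymm (h ▸ this) bot_le

/-- `A` is bounded, so `C` attracts it. Since `A` is invariant, its semi-distance to `C` is constant
in time, hence zero, and `C` is closed. -/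
theorem IsGlobalAttractor.subset {X : Type*} [MetricSpace X] {S : ℝ≥0 → X → X} {A C : Set X}
    (hA : IsGlobalAttractor S A) (hC : IsGlobalAttractor S C) : A ⊆ C := by
  have h := hC.attracts A hA.isCompact.isBounded
  simp only [hA.invariant] at h
  have h0 := tendsto_nhds_unique h tendsto_const_nhds
  have := mem_closure_of_hausdorffSemiDist_eq_zero h0.symm
  rwa [hC.isCompact.isClosed.closure_eq] at this

theorem IsGlobalAttractor.eq {X : Type*} [MetricSpace X] {S : ℝ≥0 → X → X} {A C : Set X}
    (hA : IsGlobalAttractor S A) (hC : IsGlobalAttractor S C) : A = C :=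
  (hA.subset hC).antisymm (hC.subset hA)

/-- A continuous semigroup with a compact, positively invariant set absorbing all bounded sets
has a nonempty global attractor. -/
theorem IsContinuousSemigroup.exists_isGlobalAttractor {X : Type*} [MetricSpace X]
    {S : ℝ≥0 → X → X} (hS : IsContinuousSemigroup S) {K : Set X} (hK : IsCompact K)
    (hKne : K.Nonempty) (hinv : ∀ t, S t '' K ⊆ K)
    (habs : ∀ B : Set X, Bornology.IsBounded B → ∃ T, S T '' B ⊆ K) :
    ∃ A, IsGlobalAttractor S A ∧ A.Nonempty ∧ A ⊆ K := by
  have hcont : ∀ t, Continuous (S t) := fun t =>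
    hS.continuous.comp (continuous_const.prodMk continuous_id)
  have hcpt : ∀ t, IsCompact (S t '' K) := fun t => hK.image (hcont t)
  have hanti : Antitone fun t => S t '' K := by
    rintro s t hst _ ⟨x, hx, rfl⟩
    refine ⟨S (t - s) x, hinv _ ⟨x, hx, rfl⟩, ?_⟩
    rw [← hS.add, add_tsub_cancel_of_le hst]
  have hdir : Directed (· ⊇ ·) fun t => S t '' K := hanti.directed_ge
  refine ⟨⋂ t, S t '' K, ⟨?_, ?_, ?_⟩, ?_, ?_⟩
  · exact (hcpt 0).of_isClosed_subset (isClosed_iInter fun t => (hcpt t).isClosed)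
      (Set.iInter_subset _ 0)
  · intro s
    apply Set.Subset.antisymm
    · rintro _ ⟨x, hx, rfl⟩
      rw [Set.mem_iInter] at hx ⊢
      intro t
      obtain ⟨y, hy, rfl⟩ := hx t
      refine ⟨S s y, hinv _ ⟨y, hy, rfl⟩, ?_⟩
      rw [← hS.add, add_comm, hS.add]
    · intro y hy
      rw [Set.mem_iInter] at hy
      have hcl : IsClosed (S s ⁻¹' {y}) := isClosed_singleton.preimage (hcont s)
      -- Preimages of `y` under `S s` exist in every `S t '' K`, as `y ∈ S (s + t) '' K`. Cantor's
      -- intersection theorem finds one lying in all of them.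
      have := IsCompact.nonempty_iInter_of_directed_nonempty_isCompact_isClosed
        (fun t => S t '' K ∩ S s ⁻¹' {y})
        (Antitone.directed_ge fun a b hab => Set.inter_subset_inter_left _ (hanti hab))
        (fun t => by
          obtain ⟨x, hx, hxy⟩ := hy (s + t)
          exact ⟨S t x, ⟨x, hx, rfl⟩, by simpa [← hS.add] using hxy⟩)
        (fun t => (hcpt t).inter_right hcl) (fun t => (hcpt t).isClosed.inter hcl)
      obtain ⟨x, hx⟩ := this
      rw [Set.mem_iInter] at hx
      exact ⟨x, Set.mem_iInter.2 fun t => (hx t).1, (hx 0).2⟩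
  · intro B hB
    obtain ⟨T, hT⟩ := habs B hB
    rw [ENNReal.tendsto_nhds_zero]
    intro ε hε
    have hU : IsOpen {x | Metric.infEDist x (⋂ t, S t '' K) < ε} :=
      isOpen_lt Metric.continuous_infEDist continuous_const
    -- A decreasing family of compact sets enters every open neighbourhood of its intersection.
    obtain ⟨t₀, ht₀⟩ := exists_subset_nhds_of_isCompact hdir hcpt
      (U := {x | Metric.infEDist x (⋂ t, S t '' K) < ε}) fun x hx => hU.mem_nhds (by
        simpa [Metric.infEDist_zero_of_mem hx] using hε)
    filter_upwards [eventually_ge_atTop (t₀ + T)] with t ht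
    refine iSup₂_le ?_
    rintro _ ⟨x, hx, rfl⟩
    refine (ht₀ ?_ : Metric.infEDist _ _ < ε).le
    have h1 : t = (t - T) + T := (tsub_add_cancel_of_le (le_add_self.trans ht)).symm
    rw [h1, hS.add]
    exact hanti (le_tsub_of_add_le_right ht) ⟨_, hT ⟨x, hx, rfl⟩, rfl⟩
  · exact IsCompact.nonempty_iInter_of_directed_nonempty_isCompact_isClosed _ hdir
      (fun t => hKne.image _) hcpt fun t => (hcpt t).isClosed
  · exact (Set.iInter_subset _ 0).trans (hinv 0)

/-! ### Generic continuity of upper semicontinuous maps. -/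

/-- **Fort's theorem**: an upper semicontinuous compact-valued map into a separable metric space
is continuous for the Hausdorff metric at the points of a residual set. -/
theorem exists_residual_continuousAt_of_upperSemicontinuous {P Y : Type*} [TopologicalSpace P]
    [MetricSpace Y] [SecondCountableTopology Y] (F : P → CB Y)
    (hc : ∀ p, IsCompact (F p).carrier)
    (husc : ∀ p U, IsOpen U → (F p).carrier ⊆ U → ∀ᶠ q in 𝓝 p, (F q).carrier ⊆ U) :
    ∃ Λ ∈ residual P, ∀ p ∈ Λ, ContinuousAt F p := by
  classical
  set 𝓑 := TopologicalSpace.countableBasis Y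
  set D : Set Y → Set P := fun U => {q | ((F q).carrier ∩ closure U).Nonempty} with hD
  -- If `F p` misses `closure U`, upper semicontinuity makes nearby values miss it too. A closed `D
  -- U` has a nowhere dense frontier, and lower semicontinuity can fail only on these countably many
  -- frontiers.
  have hDcl : ∀ U, IsClosed (D U) := by
    intro U
    rw [← isOpen_compl_iff, isOpen_iff_mem_nhds]
    intro p hp
    have hp' : (F p).carrier ⊆ (closure U)ᶜ := by
      intro x hx hxU
      exact hp ⟨x, hx, hxU⟩
    filter_upwards [husc p _ isClosed_closure.isOpen_compl hp'] with q hq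
    rintro ⟨x, hx, hxU⟩
    exact hq hx hxU
  refine ⟨⋂ U ∈ 𝓑, (frontier (D U))ᶜ, ?_, ?_⟩
  · refine (countable_bInter_mem (TopologicalSpace.countable_countableBasis Y)).2 fun U _ => ?_
    exact residual_of_dense_open isClosed_frontier.isOpen_compl
      (interior_eq_empty_iff_dense_compl.1 (interior_frontier (hDcl U)))
  · intro p hp
    rw [Set.mem_iInter₂] at hp
    have hlsc : ∀ a ∈ (F p).carrier, ∀ ε > 0,
        ∀ᶠ q in 𝓝 p, ∃ y ∈ (F q).carrier, dist a y < ε := by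
      intro a ha ε hε
      obtain ⟨U, hU, haU, hUb⟩ := (TopologicalSpace.isBasis_countableBasis Y).exists_subset_of_mem_open
        (Metric.mem_ball_self (half_pos hε) : a ∈ Metric.ball a (ε / 2)) Metric.isOpen_ball
      have hpD : p ∈ D U := ⟨a, ha, subset_closure haU⟩
      have hint : p ∈ interior (D U) := by
        by_contra h
        exact hp U hU (by rw [(hDcl U).frontier_eq]; exact ⟨hpD, h⟩)
      filter_upwards [mem_interior_iff_mem_nhds.1 hint] with q ⟨y, hy, hyU⟩
      have := closure_mono hUb hyU
      have := Metric.closure_ball_subset_closedBall this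
      rw [Metric.mem_closedBall, dist_comm] at this
      exact ⟨y, hy, by linarith⟩
    rw [ContinuousAt, Metric.tendsto_nhds]
    intro ε hε
    -- A finite `ε / 4`-net makes lower semicontinuity uniform over `F p`: two errors of `ε / 4`
    -- match the `ε / 2` from the thickening, and `ε / 2 < ε` restores strictness.
    obtain ⟨s, hs, hfin, hcov⟩ := (hc p).finite_cover_balls (show 0 < ε / 4 by positivity)
    have h1 : ∀ᶠ q in 𝓝 p, ∀ a ∈ s, ∃ y ∈ (F q).carrier, dist a y < ε / 4 :=
      (eventually_all_finite hfin).2 fun a ha => hlsc a (hs ha) _ (by positivity)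
    have h2 := husc p _ Metric.isOpen_thickening
      (Metric.self_subset_thickening (show 0 < ε / 2 by positivity) (F p).carrier)
    filter_upwards [h1, h2] with q hq1 hq2
    refine lt_of_le_of_lt ?_ (half_lt_self hε)
    refine Metric.hausdorffDist_le_of_mem_dist (by positivity) ?_ ?_
    · intro x hx
      obtain ⟨y, hy, hxy⟩ := Metric.mem_thickening_iff.1 (hq2 hx)
      exact ⟨y, hy, hxy.le⟩
    · intro x hx
      obtain ⟨a, ha, hxa⟩ := Set.mem_iUnion₂.1 (hcov hx)
      obtain ⟨y, hy, hay⟩ := hq1 a ha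
      refine ⟨y, hy, ?_⟩
      rw [Metric.mem_ball] at hxa
      linarith [dist_triangle x a y]

/-! ### Dissipation and regularity of the Lorenz field. -/

namespace LorenzParam

/-- The centre of the absorbing balls of the Lorenz system. -/
noncomputable def center (p : LorenzParam) : EuclideanSpace ℝ (Fin 3) := !₂[0, 0, p.σ + p.r]

noncomputable def rate (p : LorenzParam) : ℝ := min (2 * p.σ) (min 2 p.b)

noncomputable def source (p : LorenzParam) : ℝ := p.b * (p.σ + p.r) ^ 2

theorem σ_pos (p : LorenzParam) : 0 < p.σ := p.2 0

theorem b_pos (p : LorenzParam) : 0 < p.b := p.2 1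

theorem rate_pos (p : LorenzParam) : 0 < p.rate :=
  lt_min (mul_pos two_pos p.σ_pos) (lt_min two_pos p.b_pos)

theorem source_nonneg (p : LorenzParam) : 0 ≤ p.source :=
  mul_nonneg p.b_pos.le (sq_nonneg _)

theorem continuous_σ : Continuous σ := by unfold σ; fun_prop

theorem continuous_b : Continuous b := by unfold b; fun_prop

theorem continuous_r : Continuous r := by unfold r; fun_prop

theorem continuous_rate : Continuous rate :=
  (continuous_const.mul continuous_σ).min (continuous_const.min continuous_b)

theorem continuous_source : Continuous source :=
  continuous_b.mul ((continuous_σ.add continuous_r).pow 2)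

theorem continuous_center : Continuous center := by
  have := continuous_σ
  have := continuous_r
  unfold center
  refine (PiLp.continuous_toLp 2 _).comp (continuous_pi fun i => ?_)
  fin_cases i <;> simp <;> fun_prop

end LorenzParam

open LorenzParam

/-- The cubic terms cancel, and the shift `c = σ + r` in `z` cancels the `xy` terms. What remains is
`-2σx² - 2y² - 2bz(z - c)`, where `-2bz(z - c) = -bz² - b(z - c)² + bc²`. -/
theorem two_mul_inner_lorenzField_le (p : LorenzParam) (u : EuclideanSpace ℝ (Fin 3)) :
    2 * inner ℝ (u - p.center) (lorenzField p u)
      ≤ -p.rate * ‖u - p.center‖ ^ 2 + p.source := by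
  have h1 : p.rate ≤ 2 * p.σ := min_le_left _ _
  have h2 : p.rate ≤ 2 := (min_le_right _ _).trans (min_le_left _ _)
  have h3 : p.rate ≤ p.b := (min_le_right _ _).trans (min_le_right _ _)
  have hb := p.b_pos
  rw [EuclideanSpace.norm_sq_eq, PiLp.inner_apply]
  simp only [Fin.sum_univ_three, source, lorenzField, center, Real.norm_eq_abs, sq_abs,
    PiLp.sub_apply, Matrix.cons_val_zero, Matrix.cons_val_one, Matrix.cons_val,
    RCLike.inner_apply, conj_trivial, sub_zero]
  nlinarith [mul_nonneg (sub_nonneg.2 h1) (sq_nonneg (u 0)),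
    mul_nonneg (sub_nonneg.2 h2) (sq_nonneg (u 1)),
    mul_nonneg (sub_nonneg.2 h3) (sq_nonneg (u 2 - (p.σ + p.r))),
    mul_nonneg hb.le (sq_nonneg (u 2))]

theorem continuous_lorenzField :
    Continuous fun q : LorenzParam × EuclideanSpace ℝ (Fin 3) => lorenzField q.1 q.2 := by
  have := continuous_σ
  have := continuous_b
  have := continuous_r
  unfold lorenzField
  refine (PiLp.continuous_toLp 2 _).comp (continuous_pi fun i => ?_)
  fin_cases i <;> simp <;> fun_prop

theorem contDiff_lorenzField (p : LorenzParam) : ContDiff ℝ 1 (lorenzField p) := by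
  rw [contDiff_euclidean]
  intro i
  unfold lorenzField
  fin_cases i <;> simp <;> fun_prop

theorem exists_lipschitzOnWith_lorenzField (p : LorenzParam) {s : Set (EuclideanSpace ℝ (Fin 3))}
    (hs : IsCompact s) : ∃ K, LipschitzOnWith K (lorenzField p) s :=
  (contDiff_lorenzField p).locallyLipschitz.locallyLipschitzOn.exists_lipschitzOnWith_of_compact hs

/-! ### Existence on bounded intervals, energy bounds and Gronwall estimates. -/

/-- A Lipschitz bounded vector field has solutions on every interval `[0, T]`. -/
theorem exists_hasDerivWithinAt_Icc_of_lipschitz {E : Type*} [NormedAddCommGroup E]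
    [NormedSpace ℝ E] [CompleteSpace E] {g : E → E} {K M : ℝ≥0} (hg : LipschitzWith K g)
    (hM : ∀ x, ‖g x‖ ≤ M) (x : E) {T : ℝ} (hT : 0 ≤ T) :
    ∃ u : ℝ → E, u 0 = x ∧
      ∀ t ∈ Set.Icc 0 T, HasDerivWithinAt u (g (u t)) (Set.Icc 0 T) t := by
  have hPL : IsPicardLindelof (fun _ => g) (⟨0, le_rfl, hT⟩ : Set.Icc (0 : ℝ) T) x
      (M * T.toNNReal) 0 M K :=
    { lipschitzOnWith := fun _ _ => hg.lipschitzOnWith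
      continuousOn := fun _ _ => continuousOn_const
      norm_le := fun _ _ x _ => hM x
      mul_max_le := by simp [hT] }
  exact hPL.exists_eq_forall_mem_Icc_hasDerivWithinAt₀

theorem hasDerivWithinAt_norm_sub_sq {E : Type*} [NormedAddCommGroup E] [InnerProductSpace ℝ E]
    {u : ℝ → E} {v c : E} {s : Set ℝ} {t : ℝ} (h : HasDerivWithinAt u v s t) :
    HasDerivWithinAt (fun τ => ‖u τ - c‖ ^ 2) (2 * inner ℝ (u t - c) v) s t := by
  exact HasDerivWithinAt.norm_sq (HasDerivWithinAt.sub_const c h)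

/-- Cutting the field off outside a ball makes it bounded and globally Lipschitz. The solution of
the truncated equation never leaves the ball where the cutoff equals one, so it solves the original
equation. -/
theorem exists_lorenz_solution_Icc (p : LorenzParam) (x : EuclideanSpace ℝ (Fin 3)) {T : ℝ}
    (hT : 0 ≤ T) : ∃ u : ℝ → EuclideanSpace ℝ (Fin 3), u 0 = x ∧
      ∀ t ∈ Set.Icc 0 T, HasDerivWithinAt u (lorenzField p (u t)) (Set.Icc 0 T) t := by
  -- The ball contains `x`, and `ρ ≥ source / rate + 1` gives `ρ² ≥ ρ > source / rate`, so the field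
  -- points strictly inwards on its sphere.
  set ρ : ℝ := ‖x - p.center‖ + p.source / p.rate + 1 with hρ
  have hD : 0 ≤ p.source / p.rate := div_nonneg p.source_nonneg p.rate_pos.le
  have hρ1 : 1 ≤ ρ := by linarith [norm_nonneg (x - p.center)]
  let φ : ContDiffBump p.center := ⟨ρ, ρ + 1, by linarith, by linarith⟩
  set g : EuclideanSpace ℝ (Fin 3) → EuclideanSpace ℝ (Fin 3) :=
    fun u => φ u • lorenzField p u with hgdef
  have hgC : ContDiff ℝ 1 g := φ.contDiff.smul (contDiff_lorenzField p)
  have hgc : HasCompactSupport g := φ.hasCompactSupport.smul_right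
  obtain ⟨K, hK⟩ := hgC.lipschitzWith_of_hasCompactSupport hgc one_ne_zero
  obtain ⟨M, hM⟩ := hgc.exists_bound_of_continuous hgC.continuous
  have hM0 : 0 ≤ M := (norm_nonneg _).trans (hM 0)
  obtain ⟨u, hu0, hu⟩ := exists_hasDerivWithinAt_Icc_of_lipschitz hK (M := ⟨M, hM0⟩) hM x hT
  have hgin : ∀ v, ‖v - p.center‖ ≤ ρ → g v = lorenzField p v := by
    intro v hv
    have : φ v = 1 := φ.one_of_mem_closedBall (by simpa [dist_eq_norm] using hv)
    simp [hgdef, this]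
  have hbd : ∀ ⦃t⦄, t ∈ Set.Icc 0 T → ‖u t - p.center‖ ^ 2 ≤ ρ ^ 2 := by
    refine image_le_of_deriv_right_lt_deriv_boundary (B := fun _ => ρ ^ 2) (B' := fun _ => 0)
      (f' := fun t => 2 * inner ℝ (u t - p.center) (g (u t)))
      (fun t ht => (hasDerivWithinAt_norm_sub_sq (hu t ht)).continuousWithinAt)
      (fun t ht => ?_) ?_ (fun _ => hasDerivAt_const _ _) ?_
    · exact (hasDerivWithinAt_norm_sub_sq (hu t ⟨ht.1, ht.2.le⟩)).mono_of_mem_nhdsWithin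
        (mem_of_superset (Icc_mem_nhdsGE ht.2) (Set.Icc_subset_Icc_left ht.1))
    · rw [hu0]
      exact pow_le_pow_left₀ (norm_nonneg _) (by linarith) 2
    · intro t _ htρ
      have h1 : ‖u t - p.center‖ ≤ ρ := by
        rw [← abs_of_nonneg (norm_nonneg (u t - p.center)), ← abs_of_nonneg (by linarith : 0 ≤ ρ)]
        exact (sq_le_sq.1 htρ.le)
      rw [hgin _ h1]
      refine (two_mul_inner_lorenzField_le p _).trans_lt ?_
      rw [htρ]
      have h2 : p.source / p.rate < ρ ^ 2 := by
        nlinarith [norm_nonneg (x - p.center)]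
      rw [div_lt_iff₀ p.rate_pos] at h2
      linarith
  refine ⟨u, hu0, fun t ht => ?_⟩
  have h := hu t ht
  rwa [hgin _ (abs_le_of_sq_le_sq' (hbd ht) (by linarith)).2] at h

/-- The basic energy estimate. -/
theorem norm_sq_le_of_lorenz_solution {p : LorenzParam} {u : ℝ → EuclideanSpace ℝ (Fin 3)} {T : ℝ}
    (hu : ∀ t ∈ Set.Icc 0 T, HasDerivWithinAt u (lorenzField p (u t)) (Set.Icc 0 T) t) :
    ∀ t ∈ Set.Icc 0 T, ‖u t - p.center‖ ^ 2 ≤ p.source / p.rate +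
      (‖u 0 - p.center‖ ^ 2 - p.source / p.rate) * Real.exp (-p.rate * t) := by
  intro t ht
  have h := le_gronwallBound_of_liminf_deriv_right_le (f := fun t => ‖u t - p.center‖ ^ 2)
    (f' := fun t => 2 * inner ℝ (u t - p.center) (lorenzField p (u t)))
    (δ := ‖u 0 - p.center‖ ^ 2) (K := -p.rate) (ε := p.source)
    (fun t ht => (hasDerivWithinAt_norm_sub_sq (hu t ht)).continuousWithinAt)
    (fun t ht r hr => ?_) le_rfl (fun t _ => two_mul_inner_lorenzField_le p _) t ht
  · refine h.trans_eq ?_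
    rw [gronwallBound_of_K_ne_0 (neg_ne_zero.2 p.rate_pos.ne'), sub_zero]
    have := p.rate_pos.ne'
    field_simp
    ring
  · refine HasDerivWithinAt.liminf_right_slope_le ?_ hr
    exact (hasDerivWithinAt_norm_sub_sq (hu t ⟨ht.1, ht.2.le⟩)).mono_of_mem_nhdsWithin
        (mem_of_superset (Icc_mem_nhdsGE ht.2) (Set.Icc_subset_Icc_left ht.1))

theorem mem_closedBall_of_lorenz_solution {p : LorenzParam} {u : ℝ → EuclideanSpace ℝ (Fin 3)}
    {T R : ℝ} (hu : ∀ t ∈ Set.Icc 0 T, HasDerivWithinAt u (lorenzField p (u t)) (Set.Icc 0 T) t)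
    (hR : p.source / p.rate + 1 ≤ R) (h0 : u 0 ∈ Metric.closedBall p.center R) :
    ∀ t ∈ Set.Icc 0 T, u t ∈ Metric.closedBall p.center R := by
  intro t ht
  have hD : 0 ≤ p.source / p.rate := div_nonneg p.source_nonneg p.rate_pos.le
  rw [mem_closedBall_iff_norm] at h0 ⊢
  refine (abs_le_of_sq_le_sq' ((norm_sq_le_of_lorenz_solution hu t ht).trans ?_)
    (by linarith)).2
  have h1 : Real.exp (-p.rate * t) ≤ 1 :=
    Real.exp_le_one_iff.2 (by nlinarith [mul_nonneg p.rate_pos.le ht.1])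
  have h2 : ‖u 0 - p.center‖ ^ 2 ≤ R ^ 2 := pow_le_pow_left₀ (norm_nonneg _) h0 2
  have h3 := Real.exp_pos (-p.rate * t)
  -- The energy bound is a convex combination of `source / rate` and the initial squared norm, both
  -- at most `R²`.
  have h4 : p.source / p.rate ≤ R ^ 2 := by nlinarith
  nlinarith

/-- Only the field of `q` needs a Lipschitz constant. Hence `K` can stay fixed while `p` varies near
`q`; the case `p = q` gives uniqueness and dependence on initial data. -/
theorem dist_lorenz_solution_le {p q : LorenzParam} {u v : ℝ → EuclideanSpace ℝ (Fin 3)} {T : ℝ}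
    (hu : ∀ t ∈ Set.Icc 0 T, HasDerivWithinAt u (lorenzField p (u t)) (Set.Icc 0 T) t)
    (hv : ∀ t ∈ Set.Icc 0 T, HasDerivWithinAt v (lorenzField q (v t)) (Set.Icc 0 T) t)
    {s : Set (EuclideanSpace ℝ (Fin 3))} (hus : ∀ t ∈ Set.Icc 0 T, u t ∈ s)
    (hvs : ∀ t ∈ Set.Icc 0 T, v t ∈ s) {K : ℝ≥0} (hK : LipschitzOnWith K (lorenzField q) s)
    {ε : ℝ} (hε : ∀ x ∈ s, dist (lorenzField p x) (lorenzField q x) ≤ ε) :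
    ∀ t ∈ Set.Icc 0 T, dist (u t) (v t) ≤ gronwallBound (dist (u 0) (v 0)) K ε t := by
  intro t ht
  have hmem : ∀ τ ∈ Set.Ico 0 T, Set.Icc 0 T ∈ 𝓝[Set.Ici τ] τ := fun τ hτ =>
    mem_of_superset (Icc_mem_nhdsGE hτ.2) (Set.Icc_subset_Icc_left hτ.1)
  have h := dist_le_of_approx_trajectories_ODE_of_mem (v := fun _ => lorenzField q)
    (s := fun _ => s) (εg := 0) (fun _ _ => hK)
    (fun τ hτ => (hu τ hτ).continuousWithinAt)
    (fun τ hτ => (hu τ ⟨hτ.1, hτ.2.le⟩).mono_of_mem_nhdsWithin (hmem τ hτ))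
    (fun τ hτ => hε _ (hus τ ⟨hτ.1, hτ.2.le⟩)) (fun τ hτ => hus τ ⟨hτ.1, hτ.2.le⟩)
    (fun τ hτ => (hv τ hτ).continuousWithinAt)
    (fun τ hτ => (hv τ ⟨hτ.1, hτ.2.le⟩).mono_of_mem_nhdsWithin (hmem τ hτ))
    (fun τ _ => (dist_self _).le) (fun τ hτ => hvs τ ⟨hτ.1, hτ.2.le⟩) le_rfl t ht
  simpa using h

theorem dist_lorenz_solution_le_mul_exp {p : LorenzParam} {R : ℝ}
    (hR : p.source / p.rate + 1 ≤ R) :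
    ∃ K : ℝ≥0, ∀ (u v : ℝ → EuclideanSpace ℝ (Fin 3)) (T : ℝ),
      (∀ t ∈ Set.Icc 0 T, HasDerivWithinAt u (lorenzField p (u t)) (Set.Icc 0 T) t) →
      (∀ t ∈ Set.Icc 0 T, HasDerivWithinAt v (lorenzField p (v t)) (Set.Icc 0 T) t) →
      u 0 ∈ Metric.closedBall p.center R → v 0 ∈ Metric.closedBall p.center R →
      ∀ t ∈ Set.Icc 0 T, dist (u t) (v t) ≤ dist (u 0) (v 0) * Real.exp (K * t) := by
  obtain ⟨K, hK⟩ := exists_lipschitzOnWith_lorenzField p (isCompact_closedBall p.center R)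
  refine ⟨K, fun u v T hu hv hu0 hv0 t ht => ?_⟩
  have h := dist_lorenz_solution_le hu hv (mem_closedBall_of_lorenz_solution hu hR hu0)
    (mem_closedBall_of_lorenz_solution hv hR hv0) hK (ε := 0) (fun x _ => (dist_self _).le) t ht
  rwa [gronwallBound_ε0] at h

theorem lorenz_solution_unique_Icc {p : LorenzParam} {u v : ℝ → EuclideanSpace ℝ (Fin 3)} {T : ℝ}
    (hu : ∀ t ∈ Set.Icc 0 T, HasDerivWithinAt u (lorenzField p (u t)) (Set.Icc 0 T) t)
    (hv : ∀ t ∈ Set.Icc 0 T, HasDerivWithinAt v (lorenzField p (v t)) (Set.Icc 0 T) t)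
    (h0 : u 0 = v 0) : ∀ t ∈ Set.Icc 0 T, u t = v t := by
  intro t ht
  obtain ⟨K, hK⟩ := dist_lorenz_solution_le_mul_exp (p := p)
    (le_max_left _ (dist (u 0) p.center))
  have hmem : u 0 ∈ Metric.closedBall p.center (max (p.source / p.rate + 1)
    (dist (u 0) p.center)) := Metric.mem_closedBall.2 (le_max_right _ _)
  have h := hK u v T hu hv hmem (h0 ▸ hmem) t ht
  rw [h0, dist_self, zero_mul] at h
  exact dist_le_zero.1 h

/-! ### Global solutions and the semigroup. -/

theorem IsLorenzSolution.hasDerivWithinAt_Icc {p : LorenzParam}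
    {u : ℝ → EuclideanSpace ℝ (Fin 3)} (hu : IsLorenzSolution p u) (T : ℝ) :
    ∀ t ∈ Set.Icc 0 T, HasDerivWithinAt u (lorenzField p (u t)) (Set.Icc 0 T) t :=
  fun t ht => (hu t ht.1).mono Set.Icc_subset_Ici_self

theorem IsLorenzSolution.eq {p : LorenzParam} {u v : ℝ → EuclideanSpace ℝ (Fin 3)}
    (hu : IsLorenzSolution p u) (hv : IsLorenzSolution p v) (h0 : u 0 = v 0) {t : ℝ}
    (ht : 0 ≤ t) : u t = v t :=
  lorenz_solution_unique_Icc (hu.hasDerivWithinAt_Icc t) (hv.hasDerivWithinAt_Icc t) h0 t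
    ⟨ht, le_rfl⟩

theorem IsLorenzSolution.congr {p : LorenzParam} {u v : ℝ → EuclideanSpace ℝ (Fin 3)}
    (hu : IsLorenzSolution p u) (h : ∀ t, 0 ≤ t → v t = u t) : IsLorenzSolution p v := by
  intro t ht
  rw [h t ht]
  exact (hu t ht).congr h (h t ht)

theorem IsLorenzSolution.comp_add {p : LorenzParam} {u : ℝ → EuclideanSpace ℝ (Fin 3)}
    (hu : IsLorenzSolution p u) {a : ℝ} (ha : 0 ≤ a) : IsLorenzSolution p fun t => u (t + a) := by
  intro t ht
  rw [Set.mem_Ici] at ht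
  have h := (hu (t + a) (add_nonneg ht ha)).scomp t
    ((hasDerivAt_id t).add_const a).hasDerivWithinAt (s := Set.Ici 0)
    (fun s hs => add_nonneg hs ha)
  rwa [one_smul] at h

theorem exists_isLorenzSolution (p : LorenzParam) (x : EuclideanSpace ℝ (Fin 3)) :
    ∃ u, u 0 = x ∧ IsLorenzSolution p u := by
  choose U hU0 hU using fun n : ℕ => exists_lorenz_solution_Icc p x (Nat.cast_nonneg (α := ℝ) n)
  have hmono : ∀ m n : ℕ, m ≤ n → ∀ t ∈ Set.Icc (0 : ℝ) m, U m t = U n t := by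
    intro m n hmn
    have hsub : Set.Icc (0 : ℝ) m ⊆ Set.Icc (0 : ℝ) n :=
      Set.Icc_subset_Icc_right (Nat.cast_le.2 hmn)
    exact lorenz_solution_unique_Icc (hU m) (fun t ht => (hU n t (hsub ht)).mono hsub)
      ((hU0 m).trans (hU0 n).symm)
  have heq : ∀ n : ℕ, ∀ t ∈ Set.Icc (0 : ℝ) n, U ⌈t⌉₊ t = U n t := fun n t ht =>
    hmono _ _ (Nat.ceil_le.2 ht.2) t ⟨ht.1, Nat.le_ceil t⟩
  refine ⟨fun t => U ⌈t⌉₊ t, hU0 _, fun t ht => ?_⟩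
  -- The extra `1` puts `t` strictly left of the end of the interval, so a derivative within `Icc`
  -- is one within `Ici 0`, even at integer `t`.
  have htN : t < (⌈t⌉₊ + 1 : ℕ) := (Nat.le_ceil t).trans_lt (by simp)
  have htm : t ∈ Set.Icc (0 : ℝ) (⌈t⌉₊ + 1 : ℕ) := ⟨ht, htN.le⟩
  have h := (hU _ t htm).congr (heq _) (heq _ t htm)
  rw [← heq _ t htm] at h
  refine h.mono_of_mem_nhdsWithin ?_
  filter_upwards [self_mem_nhdsWithin, mem_nhdsWithin_of_mem_nhds (Iio_mem_nhds htN)] with s h1 h2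
  exact ⟨h1, le_of_lt h2⟩

/-- The semigroup generated by the Lorenz equations. -/
noncomputable def lorenzFlow (p : LorenzParam) (t : ℝ≥0) (x : EuclideanSpace ℝ (Fin 3)) :
    EuclideanSpace ℝ (Fin 3) := (exists_isLorenzSolution p x).choose t

theorem isLorenzSolution_lorenzFlow (p : LorenzParam) (x : EuclideanSpace ℝ (Fin 3)) :
    IsLorenzSolution p fun t : ℝ => lorenzFlow p t.toNNReal x :=
  (exists_isLorenzSolution p x).choose_spec.2.congr fun t ht => by
    rw [lorenzFlow, Real.coe_toNNReal t ht]

theorem lorenzFlow_zero (p : LorenzParam) (x : EuclideanSpace ℝ (Fin 3)) :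
    lorenzFlow p 0 x = x := by
  rw [lorenzFlow, NNReal.coe_zero, (exists_isLorenzSolution p x).choose_spec.1]

theorem IsLorenzSolution.eq_lorenzFlow {p : LorenzParam} {u : ℝ → EuclideanSpace ℝ (Fin 3)}
    (hu : IsLorenzSolution p u) (t : ℝ≥0) : u t = lorenzFlow p t (u 0) := by
  have h := hu.eq (isLorenzSolution_lorenzFlow p (u 0)) (by simp [lorenzFlow_zero]) t.2
  simpa using h

theorem lorenzFlow_add (p : LorenzParam) (s t : ℝ≥0) (x : EuclideanSpace ℝ (Fin 3)) :
    lorenzFlow p (s + t) x = lorenzFlow p s (lorenzFlow p t x) := by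
  have h := ((isLorenzSolution_lorenzFlow p x).comp_add t.2).eq_lorenzFlow s
  simpa [← NNReal.coe_add] using h

theorem continuous_lorenzFlow (p : LorenzParam) :
    Continuous fun q : ℝ≥0 × EuclideanSpace ℝ (Fin 3) => lorenzFlow p q.1 q.2 := by
  rw [continuous_iff_continuousAt]
  rintro ⟨t₀, x₀⟩
  obtain ⟨K, hK⟩ := dist_lorenz_solution_le_mul_exp (p := p)
    (le_max_left _ (dist x₀ p.center + 1))
  set R := max (p.source / p.rate + 1) (dist x₀ p.center + 1)
  have hx₀ : x₀ ∈ Metric.closedBall p.center R :=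
    Metric.mem_closedBall.2 ((le_add_of_nonneg_right zero_le_one).trans (le_max_right _ _))
  have hc : Continuous fun t : ℝ≥0 => lorenzFlow p t x₀ := by
    have h : ContinuousOn (fun t : ℝ => lorenzFlow p t.toNNReal x₀) (Set.Ici 0) :=
      fun t ht => (isLorenzSolution_lorenzFlow p x₀ t ht).continuousWithinAt
    have := h.comp_continuous (NNReal.continuous_coe) fun t => t.2
    simpa [Function.comp_def] using this
  have hball : ∀ᶠ q : ℝ≥0 × EuclideanSpace ℝ (Fin 3) in 𝓝 (t₀, x₀),
      q.2 ∈ Metric.ball x₀ 1 :=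
    continuous_snd.continuousAt.eventually (Metric.ball_mem_nhds _ one_pos)
  have hlim : Tendsto (fun q : ℝ≥0 × EuclideanSpace ℝ (Fin 3) =>
      dist q.2 x₀ * Real.exp (K * q.1) + dist (lorenzFlow p q.1 x₀) (lorenzFlow p t₀ x₀))
      (𝓝 (t₀, x₀)) (𝓝 0) := by
    have : Continuous (fun q : ℝ≥0 × EuclideanSpace ℝ (Fin 3) =>
      dist q.2 x₀ * Real.exp (K * q.1) + dist (lorenzFlow p q.1 x₀) (lorenzFlow p t₀ x₀)) := by
      have := hc.comp (continuous_fst (X := ℝ≥0) (Y := EuclideanSpace ℝ (Fin 3)))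
      simp only [Function.comp_def] at this
      fun_prop
    simpa using this.tendsto (t₀, x₀)
  refine tendsto_iff_dist_tendsto_zero.2
    (squeeze_zero' (Eventually.of_forall fun _ => dist_nonneg) ?_ hlim)
  filter_upwards [hball] with q hq
  refine (dist_triangle _ (lorenzFlow p q.1 x₀) _).trans (add_le_add_left ?_ _)
  have hq' : q.2 ∈ Metric.closedBall p.center R := by
    rw [Metric.mem_ball] at hq
    refine Metric.mem_closedBall.2 (le_trans ?_ (le_max_right _ _))
    linarith [dist_triangle q.2 x₀ p.center]
  have h := hK _ _ q.1 ((isLorenzSolution_lorenzFlow p q.2).hasDerivWithinAt_Icc _)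
    ((isLorenzSolution_lorenzFlow p x₀).hasDerivWithinAt_Icc _)
    (by simpa [lorenzFlow_zero] using hq') (by simpa [lorenzFlow_zero] using hx₀) q.1
    ⟨q.1.2, le_rfl⟩
  simpa [lorenzFlow_zero] using h

theorem isLorenzSemigroup_lorenzFlow (p : LorenzParam) : IsLorenzSemigroup p (lorenzFlow p) where
  semigroup := ⟨lorenzFlow_zero p, lorenzFlow_add p, continuous_lorenzFlow p⟩
  solution := isLorenzSolution_lorenzFlow p
  unique _ hu := hu.eq_lorenzFlow

theorem IsLorenzSemigroup.eq_lorenzFlow {p : LorenzParam}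
    {S : ℝ≥0 → EuclideanSpace ℝ (Fin 3) → EuclideanSpace ℝ (Fin 3)}
    (hS : IsLorenzSemigroup p S) : S = lorenzFlow p := by
  funext t x
  simpa [hS.semigroup.zero] using (hS.solution x).eq_lorenzFlow t

/-! ### The Lorenz attractor and its dependence on the parameter. -/

theorem exists_isGlobalAttractor_lorenzFlow (p : LorenzParam) :
    ∃ A, IsGlobalAttractor (lorenzFlow p) A ∧ A.Nonempty ∧
      A ⊆ Metric.closedBall p.center (p.source / p.rate + 1) := by
  have hD : 0 ≤ p.source / p.rate := div_nonneg p.source_nonneg p.rate_pos.le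
  refine (isLorenzSemigroup_lorenzFlow p).semigroup.exists_isGlobalAttractor
    (isCompact_closedBall _ _) (Metric.nonempty_closedBall.2 (by linarith)) ?_ ?_
  · rintro t _ ⟨x, hx, rfl⟩
    have h := mem_closedBall_of_lorenz_solution
      ((isLorenzSolution_lorenzFlow p x).hasDerivWithinAt_Icc t) le_rfl
      (by simpa [lorenzFlow_zero] using hx) t ⟨t.2, le_rfl⟩
    simpa using h
  · intro B hB
    obtain ⟨R, hR⟩ := hB.subset_closedBall p.center
    have hlim : Tendsto (fun t : ℝ => R ^ 2 * Real.exp (-p.rate * t)) atTop (𝓝 0) := by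
      have h1 : Tendsto (fun t : ℝ => -p.rate * t) atTop atBot :=
        tendsto_id.const_mul_atTop_of_neg (neg_lt_zero.2 p.rate_pos)
      simpa using (Real.tendsto_exp_atBot.comp h1).const_mul (R ^ 2)
    -- At time `T` the squared norm is at most `D + 1 ≤ (D + 1)²` with `D = source / rate`.
    obtain ⟨T, hT1, hT0⟩ := ((hlim.eventually (eventually_le_nhds one_pos)).and
      (eventually_ge_atTop 0)).exists
    refine ⟨⟨T, hT0⟩, ?_⟩
    rintro _ ⟨x, hx, rfl⟩
    have h := norm_sq_le_of_lorenz_solution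
      ((isLorenzSolution_lorenzFlow p x).hasDerivWithinAt_Icc T) T ⟨hT0, le_rfl⟩
    have hxR := hR hx
    rw [mem_closedBall_iff_norm] at hxR ⊢
    rw [Real.toNNReal_of_nonneg hT0, Real.toNNReal_zero, lorenzFlow_zero] at h
    refine (abs_le_of_sq_le_sq' (h.trans ?_) (by linarith)).2
    have h2 : ‖x - p.center‖ ^ 2 ≤ R ^ 2 := pow_le_pow_left₀ (norm_nonneg _) hxR 2
    have h3 := Real.exp_pos (-p.rate * T)
    nlinarith

theorem eventually_dist_lorenzFlow_lt (p₀ : LorenzParam) (R : ℝ) (T : ℝ≥0) {ε : ℝ} (hε : 0 < ε) :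
    ∀ᶠ p in 𝓝 p₀, ∀ x ∈ Metric.closedBall (0 : EuclideanSpace ℝ (Fin 3)) R,
      dist (lorenzFlow p T x) (lorenzFlow p₀ T x) < ε := by
  -- `|R| + ‖center‖` bounds the distance to `center`; the second `‖center‖` returns to balls about
  -- the origin, which do not move with `p`.
  set Q : LorenzParam → ℝ := fun p => |R| + 2 * ‖p.center‖ + p.source / p.rate + 1 with hQdef
  have hQ : Continuous Q := by
    have := continuous_center
    have := continuous_source.div₀ continuous_rate fun p => p.rate_pos.ne'
    fun_prop
  have htrap : ∀ p, ∀ x ∈ Metric.closedBall (0 : EuclideanSpace ℝ (Fin 3)) R, ∀ t ∈ Set.Icc (0 : ℝ) T,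
      lorenzFlow p t.toNNReal x ∈ Metric.closedBall (0 : EuclideanSpace ℝ (Fin 3)) (Q p) := by
    intro p x hx t ht
    have hD : 0 ≤ p.source / p.rate := div_nonneg p.source_nonneg p.rate_pos.le
    rw [mem_closedBall_zero_iff] at hx ⊢
    have h := mem_closedBall_of_lorenz_solution (R := |R| + ‖p.center‖ + p.source / p.rate + 1)
      ((isLorenzSolution_lorenzFlow p x).hasDerivWithinAt_Icc T)
      (by linarith [abs_nonneg R, norm_nonneg p.center])
      (by
        rw [mem_closedBall_iff_norm, Real.toNNReal_zero, lorenzFlow_zero]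
        linarith [norm_sub_le x p.center, le_abs_self R]) t ht
    rw [mem_closedBall_iff_norm] at h
    have := norm_le_norm_sub_add (lorenzFlow p t.toNNReal x) p.center
    simp only [hQdef]
    linarith
  set s := Metric.closedBall (0 : EuclideanSpace ℝ (Fin 3)) (Q p₀ + 1)
  obtain ⟨K, hK⟩ := exists_lipschitzOnWith_lorenzField p₀ (isCompact_closedBall 0 (Q p₀ + 1))
  obtain ⟨η, hηε, hη⟩ : ∃ η, gronwallBound 0 K η T < ε ∧ 0 < η := by
    have h : Tendsto (fun η => gronwallBound 0 K η T) (𝓝[>] 0) (𝓝 0) := by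
      have := (gronwallBound_continuous_ε 0 K T).tendsto 0
      rw [gronwallBound_ε0_δ0] at this
      exact this.mono_left nhdsWithin_le_nhds
    exact ((h.eventually (gt_mem_nhds hε)).and self_mem_nhdsWithin).exists
  have hfield : ∀ᶠ p in 𝓝 p₀, ∀ x ∈ s, dist (lorenzField p x) (lorenzField p₀ x) < η := by
    refine (isCompact_closedBall _ _).eventually_forall_of_forall_eventually fun x _ => ?_
    have hc : Continuous fun q : LorenzParam × EuclideanSpace ℝ (Fin 3) =>
        dist (lorenzField q.1 q.2) (lorenzField p₀ q.2) :=
      continuous_lorenzField.dist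
        (continuous_lorenzField.comp (continuous_const.prodMk continuous_snd))
    exact hc.continuousAt.eventually (gt_mem_nhds (by simpa using hη))
  filter_upwards [hfield, hQ.continuousAt.eventually (gt_mem_nhds (lt_add_one (Q p₀)))]
    with p hp hpQ x hx
  have h := dist_lorenz_solution_le ((isLorenzSolution_lorenzFlow p x).hasDerivWithinAt_Icc T)
    ((isLorenzSolution_lorenzFlow p₀ x).hasDerivWithinAt_Icc T)
    (fun t ht => Metric.closedBall_subset_closedBall hpQ.le (htrap p x hx t ht))
    (fun t ht => Metric.closedBall_subset_closedBall (lt_add_one _).le (htrap p₀ x hx t ht))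
    hK (fun x hx => (hp x hx).le) T ⟨T.2, le_rfl⟩
  simp only [Real.toNNReal_coe, Real.toNNReal_zero, lorenzFlow_zero, dist_self] at h
  exact h.trans_lt hηε

/-- The global attractor of the Lorenz system. -/
noncomputable def lorenzAttractor (p : LorenzParam) : CB (EuclideanSpace ℝ (Fin 3)) where
  carrier := (exists_isGlobalAttractor_lorenzFlow p).choose
  nonempty := (exists_isGlobalAttractor_lorenzFlow p).choose_spec.2.1
  isClosed := (exists_isGlobalAttractor_lorenzFlow p).choose_spec.1.isCompact.isClosed
  isBounded := (exists_isGlobalAttractor_lorenzFlow p).choose_spec.1.isCompact.isBounded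

theorem isGlobalAttractor_lorenzAttractor (p : LorenzParam) :
    IsGlobalAttractor (lorenzFlow p) (lorenzAttractor p).carrier :=
  (exists_isGlobalAttractor_lorenzFlow p).choose_spec.1

theorem lorenzAttractor_subset (p : LorenzParam) :
    (lorenzAttractor p).carrier ⊆ Metric.closedBall p.center (p.source / p.rate + 1) :=
  (exists_isGlobalAttractor_lorenzFlow p).choose_spec.2.2

theorem upperSemicontinuous_lorenzAttractor (p₀ : LorenzParam)
    (U : Set (EuclideanSpace ℝ (Fin 3))) (hU : IsOpen U) (hAU : (lorenzAttractor p₀).carrier ⊆ U) :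
    ∀ᶠ p in 𝓝 p₀, (lorenzAttractor p).carrier ⊆ U := by
  have hA := isGlobalAttractor_lorenzAttractor p₀
  obtain ⟨δ, hδ, hδU⟩ := hA.isCompact.exists_thickening_subset_open hU hAU
  set Q : LorenzParam → ℝ := fun p => ‖p.center‖ + (p.source / p.rate + 1)
  have hQ : Continuous Q := by
    have := continuous_center
    have := continuous_source.div₀ continuous_rate fun p => p.rate_pos.ne'
    fun_prop
  -- The ball of radius `Q p₀ + 1` contains the attractors of all nearby parameters. Half of `δ` is
  -- spent on attraction at `p₀`, half on comparing the two flows at time `T`.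
  obtain ⟨T, hT⟩ := ((hA.attracts _ (Metric.isBounded_closedBall (x := 0)
    (r := Q p₀ + 1))).eventually
      (gt_mem_nhds (ENNReal.ofReal_pos.2 (half_pos hδ)))).exists
  filter_upwards [eventually_dist_lorenzFlow_lt p₀ (Q p₀ + 1) T (half_pos hδ),
    hQ.continuousAt.eventually (gt_mem_nhds (lt_add_one (Q p₀)))] with p hp hpQ x hx
  apply hδU
  rw [← (isGlobalAttractor_lorenzAttractor p).invariant T] at hx
  obtain ⟨y, hy, rfl⟩ := hx
  have hy0 : y ∈ Metric.closedBall (0 : EuclideanSpace ℝ (Fin 3)) (Q p₀ + 1) := by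
    have h1 := lorenzAttractor_subset p hy
    rw [mem_closedBall_iff_norm] at h1
    rw [mem_closedBall_zero_iff]
    have h2 := norm_le_norm_sub_add y p.center
    have h3 : ‖p.center‖ + (p.source / p.rate + 1) < Q p₀ + 1 := hpQ
    linarith
  have h1 : Metric.infEDist (lorenzFlow p₀ T y) (lorenzAttractor p₀).carrier
      < ENNReal.ofReal (δ / 2) :=
    (le_iSup₂ (f := fun a (_ : a ∈ lorenzFlow p₀ T '' Metric.closedBall 0 (Q p₀ + 1)) =>
      Metric.infEDist a (lorenzAttractor p₀).carrier) _ ⟨y, hy0, rfl⟩).trans_lt hT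
  obtain ⟨z, hz, hyz⟩ := Metric.infEDist_lt_iff.1 h1
  rw [edist_lt_ofReal] at hyz
  refine Metric.mem_thickening_iff.2 ⟨z, hz, ?_⟩
  linarith [dist_triangle (lorenzFlow p T y) (lorenzFlow p₀ T y) z, hp y hy0]

/-- Needed for the density of the residual set: the parameter space is open in a locally compact
space. -/
theorem baireSpace_lorenzParam : BaireSpace LorenzParam := by
  have hopen : IsOpen {p : EuclideanSpace ℝ (Fin 3) | ∀ i, 0 < p i} := by
    simp only [Set.ofPred_forall]
    exact isOpen_iInter_of_finite fun i => isOpen_lt continuous_const (by fun_prop)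
  have : LocallyCompactSpace LorenzParam := hopen.locallyCompactSpace
  infer_instance

theorem theorem6p2 :
    ∃ (S : LorenzParam → ℝ≥0 → EuclideanSpace ℝ (Fin 3) → EuclideanSpace ℝ (Fin 3))
      (𝒜 : LorenzParam → CB (EuclideanSpace ℝ (Fin 3))),
      (∀ p, IsLorenzSemigroup p (S p) ∧ ∀ T, IsLorenzSemigroup p T → T = S p) ∧
      (∀ p, IsGlobalAttractor (S p) (𝒜 p).carrier ∧
        ∀ C, IsGlobalAttractor (S p) C → C = (𝒜 p).carrier) ∧
      ∃ Λs : Set LorenzParam, Λs ∈ residual LorenzParam ∧ Dense Λs ∧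
        ∀ p ∈ Λs, ContinuousAt 𝒜 p := by
  have := baireSpace_lorenzParam
  obtain ⟨Λs, hres, hcont⟩ := exists_residual_continuousAt_of_upperSemicontinuous lorenzAttractor
    (fun p => (isGlobalAttractor_lorenzAttractor p).isCompact) upperSemicontinuous_lorenzAttractor
  exact ⟨lorenzFlow, lorenzAttractor,
    fun p => ⟨isLorenzSemigroup_lorenzFlow p, fun _ hT => hT.eq_lorenzFlow⟩,
    fun p => ⟨isGlobalAttractor_lorenzAttractor p,
      fun _ hC => hC.eq (isGlobalAttractor_lorenzAttractor p)⟩,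
    Λs, hres, dense_of_mem_residual hres, hcont⟩
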